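/- **Theorem (Discrete uniformization of an annulus).** Let $\mathcal A$ be a closed annulus with boundary components $E_1$ and $E_2$, and let $\mathcal T$ be a finite cellular decomposition of $\mathcal A$ in which every $2$-cell is a triangle or a quadrilateral and whose $1$-skeleton is a simple graph, with vertex set $\mathcal T^{(0)}$ and edge set $\mathcal T^{(1)}$; the boundary curves $E_1,E_2$ are disjoint simple cycles of this graph. Let $c(x,y)=c(y,x)>0$ be conductances on the edges and let $k>0$. Let $g:\mathcal T^{(0)}\to\mathbb R$ be the solution of the Dirichlet problem: $g=k$ at the vertices of $E_1$, $g=0$ at the vertices of $E_2$, and $\sum_{y\sim x}c(x,y)(g(x)-g(y))=0$ at every vertex $x$ not on $E_1\cup E_2$. For a vertex $x\in E_1$ put $$\frac{\partial g}{\partial n}(x)=\sum_{y\sim x,\ y\notin E_1}c(x,y)\,(g(x)-g(y)),\qquad C=\sum_{x\in E_1}\frac{\partial g}{\partial n}(x),$$ and let $$E(g)=\sum_{[x,y]\in\mathcal T^{(1)}}c(x,y)\,(g(x)-g(y))^2$$ be the Dirichlet energy. Then $C>0$. Let $S_{\mathcal A}=(\mathbb R/C\mathbb Z)\times[0,k]$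 be the straight Euclidean cylinder of height $k$ and circumference $C$. There is a map $f$ which assigns to each edge a Euclidean rectangle in $S_{\mathcal A}$ such that: 1. for every edge $[u,v]$ with $g(u)\ge g(v)$, the rectangle $f([u,v])$ has horizontal and vertical sides, its height is $g(u)-g(v)$, its width is $c(u,v)(g(u)-g(v))$, and it occupies the heights from $g(v)$ to $g(u)$ (it is a single point if $g(u)=g(v)$); 2. every rectangle $f([u,v])$ is embedded, that is, the closed planar rectangle of these dimensions is mapped injectively into $S_{\mathcal A}$; 3. the rectangles tile $S_{\mathcal A}$: their union is $S_{\mathcal A}$, and the interior of each rectangle is disjoint from the rectangle of every other edge; 4. $f$ is boundary preserving: if an endpoint of an edge lies on $E_1$, the top side of its rectangle lies on the boundary component $(\mathbb R/C\mathbb Z)\times\{k\}$, and if an endpoint lies on $E_2$, the bottom side lies on $(\mathbb R/C\mathbb Z)\times\{0\}$. Moreover $f$ is energy preserving: $E(g)=\operatorname{Area}(S_{\mathcal A})$. -/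

import Mathlib

open Set

/-! ### Cellular decompositions of an annulus

A cellular decomposition of a compact oriented surface is recorded by its `1`-skeleton, a simple
graph `G`, together with the cyclic (counterclockwise) order of the edges around each vertex. The
boundary walks of the faces are then the orbits of the face permutation. -/

/-- A rotation system on `G`: a permutation of the darts (oriented edges) whose cycles are exactly
the sets of darts issuing from a common vertex. -/
structure RotationSystem {V : Type*} (G : SimpleGraph V) where
  rot : Equiv.Perm G.Dart
  rot_fst : ∀ d, (rot d).fst = d.fst
  rot_cyclic : ∀ d d' : G.Dart, d.fst = d'.fst → rot.SameCycle d d'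

namespace RotationSystem

variable {V : Type*} {G : SimpleGraph V} (R : RotationSystem G)

/-- Reversal of darts. -/
def reverse (G : SimpleGraph V) : Equiv.Perm G.Dart :=
  Function.Involutive.toPerm SimpleGraph.Dart.symm SimpleGraph.Dart.symm_involutive

/-- The dart following `d` on the boundary walk of the face at a fixed side of `d`: run along `d`,
and leave its endpoint along the next dart of the cyclic order there. -/
def facePerm : Equiv.Perm G.Dart := (reverse G).trans R.rot

/-- The faces: the cycles of the face permutation. -/
abbrev Face : Type _ := Quotient (Equiv.Perm.SameCycle.setoid R.facePerm)

/-- The face on whose boundary walk the dart `d` lies. -/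
def faceOf (d : G.Dart) : R.Face := Quotient.mk (Equiv.Perm.SameCycle.setoid R.facePerm) d

/-- The vertices on the boundary of a face. -/
def faceVertices (F : R.Face) : Set V := {x | ∃ d, R.faceOf d = F ∧ d.fst = x}

end RotationSystem

/-- A cellular decomposition of a closed annulus, with `1`-skeleton the simple graph `G`, all of
whose `2`-cells are triangles or quadrilaterals. The annulus is a sphere (a connected closed
oriented surface with Euler characteristic `2`) from which the interiors of two faces, the two
holes, have been removed; the boundaries of the holes are disjoint simple cycles, and they are the
two boundary components of the annulus. All other faces are the `2`-cells of the annulus. -/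
structure AnnulusDecomposition {V : Type*} (G : SimpleGraph V) extends RotationSystem G where
  connected : G.Connected
  euler : (Nat.card V : ℤ) - Nat.card G.edgeSet + Nat.card toRotationSystem.Face = 2
  /-- No boundary walk of a face passes twice through a vertex. -/
  simple_faces : ∀ d d' : G.Dart,
    toRotationSystem.faceOf d = toRotationSystem.faceOf d' → d.fst = d'.fst → d = d'
  /-- The hole bounded by `E₁`. -/
  hole₁ : toRotationSystem.Face
  /-- The hole bounded by `E₂`. -/
  hole₂ : toRotationSystem.Face
  disjoint_holes :
    Disjoint (toRotationSystem.faceVertices hole₁) (toRotationSystem.faceVertices hole₂)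
  cells : ∀ F : toRotationSystem.Face, F ≠ hole₁ → F ≠ hole₂ →
    (toRotationSystem.faceVertices F).ncard = 3 ∨ (toRotationSystem.faceVertices F).ncard = 4

namespace AnnulusDecomposition

variable {V : Type*} {G : SimpleGraph V} (T : AnnulusDecomposition G)

/-- The vertices of the boundary component `E₁`. -/
def E₁ : Set V := T.faceVertices T.hole₁

/-- The vertices of the boundary component `E₂`. -/
def E₂ : Set V := T.faceVertices T.hole₂

end AnnulusDecomposition

/-! ### Boundary value problems on a network -/

section Network

variable {V : Type*} [Fintype V] (G : SimpleGraph V) (c : V → V → ℝ)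

open Classical in
/-- The combinatorial Laplacian `Δu(x) = ∑_{y ∼ x} c(x,y) (u(x) - u(y))`. -/
noncomputable def laplacian (u : V → ℝ) (x : V) : ℝ :=
  ∑ y with G.Adj x y, c x y * (u x - u y)

open Classical in
/-- The normal derivative at `x` with respect to a set `F` of vertices:
the sum of `c(x,y) (u(x) - u(y))` over the neighbours `y` of `x` that lie in `F`. -/
noncomputable def normalDerivative (F : Set V) (u : V → ℝ) (x : V) : ℝ :=
  ∑ y with G.Adj x y ∧ y ∈ F, c x y * (u x - u y)

open Classical in
/-- The Dirichlet energy, the sum of `c(x,y) (u(x) - u(y))²` over the edges; the double sum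
meets each edge twice. -/
noncomputable def dirichletEnergy (u : V → ℝ) : ℝ :=
  (1 / 2) * ∑ x, ∑ y with G.Adj x y, c x y * (u x - u y) ^ 2

end Network

namespace AnnulusDecomposition

variable {V : Type*} [Fintype V] {G : SimpleGraph V} (T : AnnulusDecomposition G)
  (c : V → V → ℝ)

/-- `g` solves the Dirichlet problem with value `k` on `E₁` and value `0` on `E₂`. -/
structure IsDirichletSolution (k : ℝ) (g : V → ℝ) : Prop where
  on_E₁ : ∀ x ∈ T.E₁, g x = k
  on_E₂ : ∀ x ∈ T.E₂, g x = 0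
  harmonic : ∀ x, x ∉ T.E₁ → x ∉ T.E₂ → laplacian G c g x = 0

open Classical in
/-- The total flux `∑_{x ∈ E₁} ∂g/∂n(x)`; the normal derivative is taken with respect to the
vertices that are not on `E₁`. -/
noncomputable def totalFlux (g : V → ℝ) : ℝ :=
  ∑ x with x ∈ T.E₁, normalDerivative G c T.E₁ᶜ g x

end AnnulusDecomposition

/-! ### Rectangles in a straight Euclidean cylinder -/

/-- The straight Euclidean cylinder of circumference `C` and height `k`. -/
def cylinder (C k : ℝ) : Set (AddCircle C × ℝ) := univ ×ˢ Icc 0 k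

/-- The area of the cylinder, for the product of the arc length measure of the circle (of total
mass `C`) and Lebesgue measure. -/
noncomputable def cylinderArea (C k : ℝ) [Fact (0 < C)] : ℝ :=
  (MeasureTheory.volume (cylinder C k)).toReal

/-- The universal covering of the infinite cylinder by the plane, a local isometry. -/
def wrap (C : ℝ) (p : ℝ × ℝ) : AddCircle C × ℝ := ((p.1 : AddCircle C), p.2)

/-- A planar rectangle with horizontal and vertical sides; it is a point if its width and height
are zero. -/
structure Rect where
  left : ℝ
  bottom : ℝ
  width : ℝ
  height : ℝ

namespace Rect

/-- The closed planar rectangle. -/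
def box (r : Rect) : Set (ℝ × ℝ) :=
  Icc r.left (r.left + r.width) ×ˢ Icc r.bottom (r.bottom + r.height)

/-- The open planar rectangle. -/
def openBox (r : Rect) : Set (ℝ × ℝ) :=
  Ioo r.left (r.left + r.width) ×ˢ Ioo r.bottom (r.bottom + r.height)

/-- The upper side. -/
def topSide (r : Rect) : Set (ℝ × ℝ) :=
  Icc r.left (r.left + r.width) ×ˢ {r.bottom + r.height}

/-- The lower side. -/
def bottomSide (r : Rect) : Set (ℝ × ℝ) :=
  Icc r.left (r.left + r.width) ×ˢ {r.bottom}

/-- The closed rectangle placed in the cylinder of circumference `C`. -/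
def image (C : ℝ) (r : Rect) : Set (AddCircle C × ℝ) := wrap C '' r.box

/-- The interior of the rectangle placed in the cylinder of circumference `C`. -/
def openImage (C : ℝ) (r : Rect) : Set (AddCircle C × ℝ) := wrap C '' r.openBox

/-- The rectangle is embedded in the cylinder: it does not overlap or touch itself. -/
def IsEmbedded (C : ℝ) (r : Rect) : Prop := InjOn (wrap C) r.box

end Rect

/-- The family of rectangles tiles the cylinder of circumference `C` and height `k`: it covers the
cylinder and nothing else, and no member meets the interior of another one. -/
structure IsCylinderTiling {ι : Type*} (C k : ℝ) (f : ι → Rect) : Prop where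
  cover : ⋃ i, (f i).image C = cylinder C k
  no_overlap : ∀ i j, i ≠ j → Disjoint ((f i).openImage C) ((f j).image C)

/-!
The idea is that of Brooks, Smith, Stone and Tutte. The current `c(u,v) (g(u) - g(v))` is a flow on
the darts whose sources lie on `E₁` and whose sinks lie on `E₂`. On a sphere a flow without
divergence is the coboundary of a function on the faces
(`RotationSystem.exists_faceCoboundary_eq`, a dimension count from the Euler characteristic). To
reach this case, move all the sources to one vertex of `E₁` and all the sinks to one vertex of `E₂`
by flows along the boundary curves, and remove the remaining flow, which is the total flux `C`
times an integral flow. Since `g` is constant on each boundary curve, the edges on which `g` is not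
constant are not affected modulo `C`: there is a conjugate function `h` on the faces, whose
differences across the edges are the currents modulo `C` (`IsDirichletSolution.exists_conjugate`).
The rectangle of an edge stretches vertically between the values of `g` at its ends, and
horizontally between the values of `h` on its two sides.

That the rectangles tile is checked level by level. The edges which cross the level `t` downwards
have total current `C`. A face boundary that crosses the level downwards also crosses it upwards,
so every one of their arcs on `ℝ / Cℤ` ends where another one begins. Following the arcs one
returns after a positive multiple of `C`; as the total length is `C`, all arcs have been used, and
they tile the circle (`circle_tiling`, `IsDirichletSolution.level_tiling`). No planarity beyond the
existence of `h` is needed here.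

A rectangle is embedded since its width is less than `C`: otherwise its edge would be the only one
to cross some level, and would have the same face on both sides
(`AnnulusDecomposition.faceOf_symm_ne`). The energy is `k C` by Green's formula.
-/

/-! ### Arcs that tile a circle -/

section CircleTiling

/-- Arcs of positive length on the circle `ℝ / Cℤ`, of total length `C`, such that the terminal
point of each arc is the initial point of some arc, tile the circle: following the arcs one
returns after a length that is a positive multiple of `C`, so that all arcs have been used. -/
theorem circle_tiling {ι : Type*} [Fintype ι] [Nonempty ι] {C : ℝ} (hC : 0 < C)
    (a w : ι → ℝ) (hw : ∀ i, 0 < w i) (hsum : ∑ i, w i = C) (nxt : ι → ι)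
    (hnxt : ∀ i, ∃ m : ℤ, a (nxt i) = a i + w i + m * C) :
    (∀ x : ℝ, ∃ i, ∃ y ∈ Icc (a i) (a i + w i), ∃ m : ℤ, x = y + m * C) ∧
    (∀ i j, ∀ y ∈ Ico (a i) (a i + w i), ∀ y' ∈ Ico (a j) (a j + w j),
      (∃ m : ℤ, y = y' + m * C) → i = j) := by
  classical
  -- a periodic point of the successor map
  obtain ⟨d₀, hd₀⟩ : ∃ d, d ∈ Function.periodicPts nxt := by
    obtain ⟨x⟩ := ‹Nonempty ι›
    obtain ⟨p, q, hpq, he⟩ := Finite.exists_ne_map_eq_of_infinite (fun n : ℕ => nxt^[n] x)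
    wlog hlt : p < q generalizing p q
    · exact this q p hpq.symm he.symm (by omega)
    refine ⟨nxt^[p] x, Function.mk_mem_periodicPts (n := q - p) (by omega) ?_⟩
    change nxt^[q - p] (nxt^[p] x) = nxt^[p] x
    rw [← Function.iterate_add_apply, show q - p + p = q by omega]
    exact he.symm
  set n := Function.minimalPeriod nxt d₀ with hn
  have hnpos : 0 < n := Function.minimalPeriod_pos_of_mem_periodicPts hd₀
  set d : ℕ → ι := fun i => nxt^[i] d₀ with hd
  have hdn : d n = d₀ := Function.isPeriodicPt_minimalPeriod nxt d₀
  have hinj : Set.InjOn d (Set.Iio n) := Function.iterate_injOn_Iio_minimalPeriod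
  set S : ℕ → ℝ := fun i => ∑ j ∈ Finset.range i, w (d j) with hS
  have hSsucc : ∀ i, S (i + 1) = S i + w (d i) := fun i => Finset.sum_range_succ _ _
  have hSmono : StrictMono S := strictMono_nat_of_lt_succ fun i => by
    rw [hSsucc]; linarith [hw (d i)]
  have hS0 : S 0 = 0 := by simp [hS]
  have hpos : ∀ i, ∃ m : ℤ, a (d i) = a d₀ + S i + m * C := by
    intro i
    induction i with
    | zero => exact ⟨0, by simp [hd, hS0]⟩
    | succ i ih =>
      obtain ⟨m, hm⟩ := ih
      obtain ⟨m', hm'⟩ := hnxt (d i)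
      refine ⟨m + m', ?_⟩
      have : d (i + 1) = nxt (d i) := Function.iterate_succ_apply' _ _ _
      rw [this, hm', hm, hSsucc]; push_cast; ring
  have hSimg : S n = ∑ i ∈ (Finset.range n).image d, w i := by
    rw [Finset.sum_image]
    intro x hx y hy h
    exact hinj (by simpa using hx) (by simpa using hy) h
  have hSle : S n ≤ C := by
    rw [hSimg, ← hsum]
    exact Finset.sum_le_sum_of_subset_of_nonneg (Finset.subset_univ _) fun i _ _ => (hw i).le
  have hSn : S n = C := by
    obtain ⟨m, hm⟩ := hpos n
    rw [hdn] at hm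
    have h1 : S n = ((-m : ℤ) : ℝ) * C := by push_cast; linarith
    have h2 : 0 < S n := by rw [← hS0]; exact hSmono hnpos
    have h3 : (0 : ℝ) < ((-m : ℤ) : ℝ) := by
      rw [h1] at h2; exact pos_of_mul_pos_left h2 hC.le
    have h4 : (1 : ℝ) ≤ ((-m : ℤ) : ℝ) := by exact_mod_cast h3
    apply le_antisymm hSle
    rw [h1]; nlinarith
  have hsurj : ∀ i, ∃ j < n, d j = i := by
    intro i
    by_contra! hi
    have hni : i ∉ (Finset.range n).image d := by
      simp only [Finset.mem_image, Finset.mem_range, not_exists, not_and]; exact hi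
    have : ∑ j ∈ insert i ((Finset.range n).image d), w j ≤ ∑ j, w j :=
      Finset.sum_le_sum_of_subset_of_nonneg (Finset.subset_univ _) fun i _ _ => (hw i).le
    rw [Finset.sum_insert hni, ← hSimg, hSn, hsum] at this
    linarith [hw i]
  constructor
  · intro x
    set y := toIcoMod hC (a d₀) x with hy
    have hymem := toIcoMod_mem_Ico hC (a d₀) x
    rw [← hy] at hymem
    have hex : ∃ i, y - a d₀ < S (i + 1) := ⟨n - 1, by
      rw [show n - 1 + 1 = n by omega, hSn]; linarith [hymem.2]⟩
    have hlow : S (Nat.find hex) ≤ y - a d₀ := by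
      rcases Nat.eq_zero_or_pos (Nat.find hex) with h0 | h0
      · rw [h0, hS0]; linarith [hymem.1]
      · have := Nat.find_min hex (m := Nat.find hex - 1) (by omega)
        rw [show Nat.find hex - 1 + 1 = Nat.find hex by omega] at this
        exact not_lt.mp this
    have hup := Nat.find_spec hex
    set i := Nat.find hex
    obtain ⟨m, hm⟩ := hpos i
    refine ⟨d i, y + m * C, ⟨by linarith, ?_⟩, toIcoDiv hC (a d₀) x - m, ?_⟩
    · rw [hSsucc] at hup; linarith
    · have := toIcoMod_add_toIcoDiv_zsmul hC (a d₀) x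
      rw [zsmul_eq_mul, ← hy] at this
      push_cast
      linarith
  · intro i j y hy y' hy' ⟨m, hm⟩
    obtain ⟨p, hp, rfl⟩ := hsurj i
    obtain ⟨q, hq, rfl⟩ := hsurj j
    obtain ⟨mp, hmp⟩ := hpos p
    obtain ⟨mq, hmq⟩ := hpos q
    have hp1 : S (p + 1) ≤ C := hSn ▸ hSmono.monotone hp
    have hq1 : S (q + 1) ≤ C := hSn ▸ hSmono.monotone hq
    have hp0 : 0 ≤ S p := hS0 ▸ hSmono.monotone (Nat.zero_le p)
    have hq0 : 0 ≤ S q := hS0 ▸ hSmono.monotone (Nat.zero_le q)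
    have sp := hSsucc p
    have sq := hSsucc q
    obtain ⟨hy1, hy2⟩ := hy
    obtain ⟨hy'1, hy'2⟩ := hy'
    -- both points, moved into the same period, agree
    have hz : m + mq - mp = 0 := by
      have h1 : ((m + mq - mp : ℤ) : ℝ) * C < 1 * C := by push_cast; linarith
      have h2 : (-1 : ℝ) * C < ((m + mq - mp : ℤ) : ℝ) * C := by push_cast; linarith
      have h3 := lt_of_mul_lt_mul_right h1 hC.le
      have h4 := lt_of_mul_lt_mul_right h2 hC.le
      have h3' : m + mq - mp < 1 := by exact_mod_cast h3
      have h4' : -1 < m + mq - mp := by exact_mod_cast h4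
      omega
    have hz' : (m : ℝ) + mq - mp = 0 := by exact_mod_cast hz
    have hz'' : (m : ℝ) * C + mq * C - mp * C = 0 := by rw [← add_mul, ← sub_mul, hz', zero_mul]
    have h1 : p < q + 1 := hSmono.lt_iff_lt.mp (by linarith)
    have h2 : q < p + 1 := hSmono.lt_iff_lt.mp (by linarith)
    rw [show p = q by omega]

end CircleTiling

/-! ### Flows on a graph -/

section Flows

open scoped Classical

variable {V : Type*} {G : SimpleGraph V}

/-- The flows on `G`: the functions on darts that change sign under reversal. -/
def flows (G : SimpleGraph V) : Submodule ℝ (G.Dart → ℝ) where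
  carrier := {ψ | ∀ d, ψ d.symm = -ψ d}
  add_mem' {ψ χ} hψ hχ d := by simp [hψ d, hχ d]; ring
  zero_mem' d := by simp
  smul_mem' r ψ hψ d := by simp [hψ d]

variable [Fintype V]

/-- The divergence of a flow: the total amount leaving each vertex. -/
noncomputable def divergence (G : SimpleGraph V) : (G.Dart → ℝ) →ₗ[ℝ] (V → ℝ) where
  toFun ψ x := ∑ d : G.Dart with d.fst = x, ψ d
  map_add' ψ χ := by ext x; simp [Finset.sum_add_distrib]
  map_smul' r ψ := by ext x; simp [Finset.mul_sum]

theorem divergence_apply (ψ : G.Dart → ℝ) (x : V) :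
    divergence G ψ x = ∑ d : G.Dart with d.fst = x, ψ d := rfl

theorem sum_symm (ψ : G.Dart → ℝ) : ∑ d : G.Dart, ψ d.symm = ∑ d, ψ d :=
  Equiv.sum_comp (RotationSystem.reverse G) ψ

theorem sum_divergence_filter (ψ : G.Dart → ℝ) (P : V → Prop) :
    ∑ x with P x, divergence G ψ x = ∑ d : G.Dart with P d.fst, ψ d := by
  simp only [divergence_apply]
  rw [← Finset.sum_fiberwise_of_maps_to (s := Finset.univ.filter fun d : G.Dart => P d.fst)
    (t := Finset.univ.filter P) (g := fun d : G.Dart => d.fst) (by simp)]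
  refine Finset.sum_congr rfl fun x hx => Finset.sum_congr ?_ fun _ _ => rfl
  ext d
  simp only [Finset.mem_filter, Finset.mem_univ, true_and] at hx ⊢
  constructor
  · rintro rfl; exact ⟨hx, rfl⟩
  · exact fun h => h.2

/-- The flow out of a set of vertices passes through the darts that leave it. -/
theorem sum_divergence_eq_sum_leaving {ψ : G.Dart → ℝ} (hψ : ψ ∈ flows G) (P : V → Prop) :
    ∑ x with P x, divergence G ψ x = ∑ d : G.Dart with P d.fst ∧ ¬ P d.snd, ψ d := by
  rw [sum_divergence_filter, ← Finset.sum_filter_add_sum_filter_not _ (fun d : G.Dart => P d.snd),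
    Finset.filter_filter, Finset.filter_filter]
  have : ∑ d : G.Dart with P d.fst ∧ P d.snd, ψ d = 0 := by
    have h := sum_symm fun d : G.Dart => if P d.fst ∧ P d.snd then ψ d else 0
    have h2 : ∑ d : G.Dart, (if P d.symm.fst ∧ P d.symm.snd then ψ d.symm else 0) =
        -∑ d : G.Dart, (if P d.fst ∧ P d.snd then ψ d else 0) := by
      rw [← Finset.sum_neg_distrib]
      refine Finset.sum_congr rfl fun d _ => ?_
      simp only [SimpleGraph.Dart.symm_toProd, Prod.fst_swap, Prod.snd_swap, hψ d,
        and_comm (a := P d.snd)]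
      split_ifs <;> simp
    rw [Finset.sum_filter]
    linarith
  rw [this, zero_add]

theorem sum_divergence {ψ : G.Dart → ℝ} (hψ : ψ ∈ flows G) : ∑ x, divergence G ψ x = 0 := by
  simpa using sum_divergence_eq_sum_leaving hψ fun _ => True

/-- A unit flow along a path. -/
theorem exists_unit_flow {r : V → V → Prop} (hr : ∀ x y, r x y → G.Adj x y) {x y : V}
    (hxy : Relation.ReflTransGen r x y) :
    ∃ ψ : G.Dart → ℤ, (fun d => (ψ d : ℝ)) ∈ flows G ∧
      (∀ d, ψ d ≠ 0 → r d.fst d.snd ∨ r d.snd d.fst) ∧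
      divergence G (fun d => (ψ d : ℝ)) = Pi.single x 1 - Pi.single y 1 := by
  induction hxy with
  | refl => exact ⟨0, fun d => by simp, by simp, by ext z; simp [divergence_apply]⟩
  | @tail y z _ hyz ih =>
    obtain ⟨ψ, h1, h2, h3⟩ := ih
    let e : G.Dart := ⟨(y, z), hr y z hyz⟩
    refine ⟨fun d => ψ d + ((if d = e then 1 else 0) - if d = e.symm then 1 else 0), ?_, ?_, ?_⟩
    · intro d
      have h := h1 d
      have e1 : d.symm = e ↔ d = e.symm :=
        ⟨fun h => by rw [← h, SimpleGraph.Dart.symm_symm],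
          fun h => by rw [h, SimpleGraph.Dart.symm_symm]⟩
      have e2 : d.symm = e.symm ↔ d = e := SimpleGraph.Dart.symm_involutive.injective.eq_iff
      simp only [e1, e2]
      push_cast
      push_cast at h
      rw [h]; ring
    · intro d hd
      by_cases hd1 : d = e
      · left; subst hd1; exact hyz
      by_cases hd2 : d = e.symm
      · right; subst hd2; exact hyz
      · exact h2 d (by simpa [hd1, hd2] using hd)
    · have : (fun d => ((ψ d + ((if d = e then 1 else 0) - if d = e.symm then 1 else 0) : ℤ) : ℝ))
          = (fun d => (ψ d : ℝ)) + (Pi.single e 1 - Pi.single e.symm 1) := by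
        ext d; simp [Pi.single_apply]
      have hs : ∀ e : G.Dart, divergence G (Pi.single e 1) = Pi.single e.fst 1 := by
        intro e; ext w
        simp only [divergence_apply, Pi.single_apply, Finset.sum_ite_eq', Finset.mem_filter,
          Finset.mem_univ, true_and]
        exact if_congr eq_comm rfl rfl
      rw [this, map_add, map_sub, h3, hs, hs]
      change Pi.single x 1 - Pi.single y 1 + (Pi.single y 1 - Pi.single z 1) = _
      abel

/-- Sources and sinks can be concentrated at a single vertex `p` by a flow along any paths that
connect them to `p`. -/
theorem exists_flow_concentrating {r : V → V → Prop} (hr : ∀ x y, r x y → G.Adj x y) (p : V)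
    (b : V → ℝ) (hb : ∀ x, b x ≠ 0 → Relation.ReflTransGen r x p) :
    ∃ ψ ∈ flows G, (∀ d, ψ d ≠ 0 → r d.fst d.snd ∨ r d.snd d.fst) ∧
      divergence G ψ = b - Pi.single p (∑ x, b x) := by
  have : ∀ x, ∃ ψ ∈ flows G, (∀ d, ψ d ≠ 0 → r d.fst d.snd ∨ r d.snd d.fst) ∧
      divergence G ψ = Pi.single x (b x) - Pi.single p (b x) := by
    intro x
    by_cases hx : b x = 0
    · exact ⟨0, Submodule.zero_mem _, by simp, by simp [hx]⟩
    · obtain ⟨ψ, h1, h2, h3⟩ := exists_unit_flow hr (hb x hx)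
      refine ⟨b x • fun d => (ψ d : ℝ), Submodule.smul_mem _ _ h1, fun d hd => h2 d ?_, ?_⟩
      · rintro h; simp [h] at hd
      · rw [map_smul, h3, smul_sub, ← Pi.single_smul, ← Pi.single_smul]; simp
  choose ψ h1 h2 h3 using this
  refine ⟨∑ x, ψ x, Submodule.sum_mem _ fun x _ => h1 x, fun d hd => ?_, ?_⟩
  · rw [Finset.sum_apply] at hd
    obtain ⟨x, -, hx⟩ := Finset.exists_ne_zero_of_sum_ne_zero hd
    exact h2 x d hx
  · rw [map_sum, Finset.sum_congr rfl fun x _ => h3 x, Finset.sum_sub_distrib]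
    congr 1
    · exact Finset.univ_sum_single b
    · ext z
      by_cases hz : z = p <;> simp [hz, Finset.sum_apply]

theorem finrank_flows_le : Module.finrank ℝ (flows G) ≤ Nat.card G.edgeSet := by
  have hd : ∀ e : G.edgeSet, ∃ d : G.Dart, d.edge = e := by
    rintro ⟨e, he⟩
    induction e with
    | _ x y => exact ⟨⟨(x, y), he⟩, rfl⟩
  choose o ho using hd
  let L : flows G →ₗ[ℝ] (G.edgeSet → ℝ) := (LinearMap.funLeft ℝ ℝ o).comp (flows G).subtype
  have hL : Function.Injective L := by
    rw [← LinearMap.ker_eq_bot, LinearMap.ker_eq_bot']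
    rintro ⟨ψ, hψ⟩ h
    ext d
    have h0 : ψ (o ⟨d.edge, d.edge_mem⟩) = 0 := congrFun h ⟨d.edge, d.edge_mem⟩
    rcases SimpleGraph.dart_edge_eq_iff _ _ |>.mp (ho ⟨d.edge, d.edge_mem⟩) with h' | h'
    · rw [h'] at h0; exact h0
    · rw [h', hψ d] at h0; simpa using h0
  have := LinearMap.finrank_le_finrank_of_injective hL
  rwa [Module.finrank_fintype_fun_eq_card, ← Nat.card_eq_fintype_card] at this

/-- In a connected graph every function of total mass zero is the divergence of a flow. -/
theorem card_le_finrank_range_divergence (hG : G.Connected) :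
    Nat.card V ≤ Module.finrank ℝ (LinearMap.range ((divergence G).domRestrict (flows G))) + 1 := by
  obtain ⟨p⟩ := hG.nonempty
  let S : (V → ℝ) →ₗ[ℝ] ℝ := ∑ x, LinearMap.proj x
  have hS : ∀ b, S b = ∑ x, b x := fun b => by simp [S]
  have hle : LinearMap.ker S ≤ LinearMap.range ((divergence G).domRestrict (flows G)) := by
    intro b hb
    have hb' : ∑ x, b x = 0 := by rw [← hS]; exact hb
    obtain ⟨ψ, h1, -, h3⟩ := exists_flow_concentrating (G := G) (r := G.Adj) (fun _ _ h => h) p b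
      fun x _ => (SimpleGraph.reachable_iff_reflTransGen x p).mp (hG.preconnected x p)
    exact ⟨⟨ψ, h1⟩, by simpa [hb'] using h3⟩
  have h1 := Submodule.finrank_mono hle
  have h2 := LinearMap.finrank_range_add_finrank_ker S
  have h3 : Module.finrank ℝ (LinearMap.range S) ≤ 1 :=
    (Submodule.finrank_le _).trans (by simp)
  rw [Module.finrank_fintype_fun_eq_card, ← Nat.card_eq_fintype_card] at h2
  omega

end Flows

/-! ### Faces of a rotation system -/

section Faces

open scoped Classical

variable {V : Type*} {G : SimpleGraph V}

theorem SimpleGraph.Connected.mem_of_closed (hG : G.Connected) {S : Set V} {x : V}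
    (hx : x ∈ S) (hS : ∀ y z, G.Adj y z → y ∈ S → z ∈ S) (y : V) : y ∈ S := by
  have h := (SimpleGraph.reachable_iff_reflTransGen x y).mp (hG.preconnected x y)
  induction h with
  | refl => exact hx
  | tail _ hbc ih => exact hS _ _ hbc ih

namespace RotationSystem

variable (R : RotationSystem G)

theorem facePerm_apply (d : G.Dart) : R.facePerm d = R.rot d.symm := rfl

theorem facePerm_fst (d : G.Dart) : (R.facePerm d).fst = d.snd := R.rot_fst d.symm

theorem faceOf_eq_iff {d e : G.Dart} : R.faceOf d = R.faceOf e ↔ R.facePerm.SameCycle d e :=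
  Quotient.eq (r := Equiv.Perm.SameCycle.setoid R.facePerm)

theorem faceOf_facePerm (d : G.Dart) : R.faceOf (R.facePerm d) = R.faceOf d :=
  R.faceOf_eq_iff.mpr ⟨-1, by simp⟩

theorem faceOf_rot (d : G.Dart) : R.faceOf (R.rot d) = R.faceOf d.symm := by
  rw [← R.faceOf_facePerm d.symm, facePerm_apply, SimpleGraph.Dart.symm_symm]

theorem fst_mem_faceVertices (d : G.Dart) : d.fst ∈ R.faceVertices (R.faceOf d) := ⟨d, rfl, rfl⟩

theorem snd_mem_faceVertices (d : G.Dart) : d.snd ∈ R.faceVertices (R.faceOf d) :=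
  ⟨R.facePerm d, R.faceOf_facePerm d, R.facePerm_fst d⟩

theorem faceVertices_nonempty (F : R.Face) : (R.faceVertices F).Nonempty := by
  obtain ⟨d, rfl⟩ := Quotient.exists_rep F
  exact ⟨d.fst, R.fst_mem_faceVertices d⟩

/-- A function on the darts that is invariant under reversal and under the rotation is constant. -/
theorem eq_of_invariant (hG : G.Connected) {α : Type*} (k : G.Dart → α)
    (hs : ∀ d, k d.symm = k d) (hr : ∀ d, k (R.rot d) = k d) (d e : G.Dart) : k d = k e := by
  have hr' : ∀ d e : G.Dart, d.fst = e.fst → k d = k e := by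
    intro d e hde
    obtain ⟨n, rfl⟩ := R.rot_cyclic d e hde
    have : ∀ (n : ℕ) d, k ((R.rot ^ n) d) = k d := by
      intro n
      induction n with
      | zero => intro d; rfl
      | succ n ih => intro d; rw [pow_succ, Equiv.Perm.mul_apply, ih, hr]
    cases n with
    | ofNat n => exact (this n d).symm
    | negSucc n =>
      rw [zpow_negSucc]
      have h := this (n + 1) ((R.rot ^ (n + 1))⁻¹ d)
      rw [← Equiv.Perm.mul_apply, mul_inv_cancel, Equiv.Perm.one_apply] at h
      exact h
  refine hG.mem_of_closed (S := {y | ∀ e : G.Dart, e.fst = y → k d = k e}) (x := d.fst)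
    (fun e he => hr' d e he.symm) ?_ e.fst e rfl
  intro y z hyz hy e he
  rw [hy ⟨(y, z), hyz⟩ rfl, ← hs]
  exact hr' _ _ he.symm

/-- The boundary walk of a face runs through all its vertices. -/
theorem reflTransGen_of_mem_faceVertices [Finite V] (F : R.Face) {x y : V}
    (hx : x ∈ R.faceVertices F) (hy : y ∈ R.faceVertices F) :
    Relation.ReflTransGen
      (fun x y => G.Adj x y ∧ x ∈ R.faceVertices F ∧ y ∈ R.faceVertices F) x y := by
  have := Fintype.ofFinite V
  obtain ⟨d, rfl, rfl⟩ := hx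
  obtain ⟨e, he, rfl⟩ := hy
  obtain ⟨n, rfl⟩ := (R.faceOf_eq_iff.mp he.symm).exists_nat_pow_eq
  clear he
  induction n with
  | zero => exact Relation.ReflTransGen.refl
  | succ n ih =>
    refine ih.tail ?_
    have h : R.faceOf ((R.facePerm ^ n) d) = R.faceOf d :=
      R.faceOf_eq_iff.mpr (Equiv.Perm.SameCycle.symm ⟨n, by simp⟩)
    have h1 := R.fst_mem_faceVertices ((R.facePerm ^ n) d)
    have h2 := R.snd_mem_faceVertices ((R.facePerm ^ n) d)
    rw [h] at h1 h2
    rw [pow_succ', Equiv.Perm.mul_apply, facePerm_fst]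
    exact ⟨((R.facePerm ^ n) d).adj, h1, h2⟩

/-- The boundary walk of a face is closed, so if it leaves a set of vertices, then it also
enters it. -/
theorem exists_entering_of_leaving [Finite V] (P : V → Prop) (d : G.Dart) (h1 : P d.fst)
    (h2 : ¬ P d.snd) : ∃ e, R.faceOf e = R.faceOf d ∧ ¬ P e.fst ∧ P e.snd := by
  have := Fintype.ofFinite V
  by_contra! H
  have key : ∀ n : ℕ, ¬ P ((R.facePerm ^ (n + 1)) d).fst := by
    intro n
    induction n with
    | zero => rwa [zero_add, pow_one, facePerm_fst]
    | succ n ih =>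
      rw [pow_succ', Equiv.Perm.mul_apply, facePerm_fst]
      exact H _ (R.faceOf_eq_iff.mpr (Equiv.Perm.SameCycle.symm ⟨(n + 1 : ℕ), rfl⟩)) ih
  have := key (orderOf R.facePerm - 1)
  rw [Nat.sub_add_cancel (orderOf_pos _), pow_orderOf_eq_one] at this
  exact this h1

/-- The coboundary of a function on the faces: the flow along `d` is the difference of the values
on the two sides of `d`. -/
noncomputable def faceCoboundary : (R.Face → ℝ) →ₗ[ℝ] (G.Dart → ℝ) :=
  LinearMap.funLeft ℝ ℝ R.faceOf - LinearMap.funLeft ℝ ℝ fun d => R.faceOf d.symm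

theorem faceCoboundary_apply (h : R.Face → ℝ) (d : G.Dart) :
    R.faceCoboundary h d = h (R.faceOf d) - h (R.faceOf d.symm) := rfl

theorem faceCoboundary_mem_flows [Fintype V] (h : R.Face → ℝ) : R.faceCoboundary h ∈ flows G := by
  intro d
  simp [faceCoboundary_apply]

theorem divergence_faceCoboundary [Fintype V] (h : R.Face → ℝ) :
    divergence G (R.faceCoboundary h) = 0 := by
  ext x
  simp only [divergence_apply, faceCoboundary_apply, Finset.sum_sub_distrib, Pi.zero_apply,
    ← R.faceOf_rot, sub_eq_zero]
  symm
  refine Finset.sum_equiv R.rot (fun d => ?_) fun d _ => rfl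
  simp [R.rot_fst]

theorem card_face_le_finrank_range [Finite V] (hG : G.Connected) :
    Nat.card R.Face ≤ Module.finrank ℝ (LinearMap.range R.faceCoboundary) + 1 := by
  have := Fintype.ofFinite V
  have h2 := LinearMap.finrank_range_add_finrank_ker R.faceCoboundary
  have h3 : Module.finrank ℝ (LinearMap.ker R.faceCoboundary) ≤ 1 := by
    rw [finrank_le_one_iff]
    by_cases hF : Nonempty R.Face
    · refine ⟨⟨1, by ext d; simp [faceCoboundary_apply]⟩, ?_⟩
      rintro ⟨h, hh⟩
      obtain ⟨F⟩ := hF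
      refine ⟨h F, ?_⟩
      ext F'
      change h F * 1 = h F'
      rw [mul_one]
      obtain ⟨d, rfl⟩ := Quotient.exists_rep F
      obtain ⟨d', rfl⟩ := Quotient.exists_rep F'
      have hs : ∀ d, h (R.faceOf d.symm) = h (R.faceOf d) := fun d =>
        (sub_eq_zero.mp (congrFun hh d)).symm
      exact R.eq_of_invariant hG (fun d => h (R.faceOf d)) hs
        (fun d => by rw [R.faceOf_rot, hs]) d d'
    · have : IsEmpty R.Face := not_nonempty_iff.mp hF
      exact ⟨0, fun w => ⟨0, Subsingleton.elim _ _⟩⟩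
  rw [Module.finrank_fintype_fun_eq_card, ← Nat.card_eq_fintype_card] at h2
  omega

/-- On a sphere every flow without divergence is a coboundary of a function on the faces. This is
the vanishing of the first homology, by a dimension count from the Euler characteristic. -/
theorem exists_faceCoboundary_eq [Fintype V] (hG : G.Connected)
    (euler : (Nat.card V : ℤ) - Nat.card G.edgeSet + Nat.card R.Face = 2)
    {ψ : G.Dart → ℝ} (hψ : ψ ∈ flows G) (hdiv : divergence G ψ = 0) :
    ∃ h, R.faceCoboundary h = ψ := by
  let D := (divergence G).domRestrict (flows G)
  let δ : (R.Face → ℝ) →ₗ[ℝ] flows G :=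
    R.faceCoboundary.codRestrict (flows G) R.faceCoboundary_mem_flows
  have hle : LinearMap.range δ ≤ LinearMap.ker D := by
    rintro _ ⟨h, rfl⟩
    exact R.divergence_faceCoboundary h
  have hrange : Module.finrank ℝ (LinearMap.range δ) =
      Module.finrank ℝ (LinearMap.range R.faceCoboundary) := by
    have h1 := LinearMap.finrank_range_add_finrank_ker δ
    have h2 := LinearMap.finrank_range_add_finrank_ker R.faceCoboundary
    rw [LinearMap.ker_codRestrict] at h1
    omega
  have h1 := finrank_flows_le (G := G)
  have h2 : Nat.card V ≤ Module.finrank ℝ (LinearMap.range D) + 1 :=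
    card_le_finrank_range_divergence hG
  have h3 := R.card_face_le_finrank_range hG
  have h4 := LinearMap.finrank_range_add_finrank_ker D
  have heq := Submodule.eq_of_le_of_finrank_le hle (by omega)
  have hmem : (⟨ψ, hψ⟩ : flows G) ∈ LinearMap.ker D := hdiv
  rw [← heq] at hmem
  obtain ⟨h, hh⟩ := hmem
  exact ⟨h, congrArg Subtype.val hh⟩

end RotationSystem

end Faces

/-! ### Currents -/

section Current

open scoped Classical

variable {V : Type*} {G : SimpleGraph V} {c : V → V → ℝ}

/-- The current of a potential `u` along the darts. -/
def current (G : SimpleGraph V) (c : V → V → ℝ) (u : V → ℝ) (d : G.Dart) : ℝ :=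
  c d.fst d.snd * (u d.fst - u d.snd)

theorem current_mem_flows (hc_symm : ∀ u v, G.Adj u v → c u v = c v u) (u : V → ℝ) :
    current G c u ∈ flows G := by
  intro d
  change c d.snd d.fst * (u d.snd - u d.fst) = -(c d.fst d.snd * (u d.fst - u d.snd))
  rw [hc_symm _ _ d.adj]; ring

theorem current_pos (hc_pos : ∀ u v, G.Adj u v → 0 < c u v) {u : V → ℝ} {d : G.Dart}
    (hd : u d.snd < u d.fst) : 0 < current G c u d :=
  mul_pos (hc_pos _ _ d.adj) (sub_pos.mpr hd)

variable [Fintype V]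

theorem sum_dart_fst_eq (f : V → V → ℝ) (x : V) :
    ∑ d : G.Dart with d.fst = x, f d.fst d.snd = ∑ y with G.Adj x y, f x y := by
  refine Finset.sum_bij (fun d _ => d.snd) ?_ ?_ ?_ ?_
  · intro d hd
    simp only [Finset.mem_filter, Finset.mem_univ, true_and] at hd ⊢
    exact hd ▸ d.adj
  · intro d hd e he h
    simp only [Finset.mem_filter, Finset.mem_univ, true_and] at hd he
    exact SimpleGraph.Dart.ext _ _ (Prod.ext (hd.trans he.symm) h)
  · intro y hy
    simp only [Finset.mem_filter, Finset.mem_univ, true_and] at hy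
    exact ⟨⟨(x, y), hy⟩, by simp, rfl⟩
  · intro d hd
    simp only [Finset.mem_filter, Finset.mem_univ, true_and] at hd
    rw [hd]

theorem divergence_current (u : V → ℝ) (x : V) :
    divergence G (current G c u) x = laplacian G c u x :=
  sum_dart_fst_eq (fun x y => c x y * (u x - u y)) x

/-- The maximum principle. -/
theorem le_of_laplacian_eq_zero (hG : G.Connected) (hc_pos : ∀ u v, G.Adj u v → 0 < c u v)
    {u : V → ℝ} {B : Set V} (hB : B.Nonempty) {M : ℝ} (hM : ∀ x ∈ B, u x ≤ M)
    (hu : ∀ x ∉ B, laplacian G c u x = 0) (x : V) : u x ≤ M := by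
  have := hG.nonempty
  obtain ⟨p, hp⟩ := Finite.exists_max u
  by_contra! hx
  obtain ⟨b, hb⟩ := hB
  have hbp : b ∈ {y | u y = u p} := by
    refine hG.mem_of_closed (S := {y | u y = u p}) (x := p) rfl ?_ b
    intro y z hyz hy
    have hyB : y ∉ B := fun h => by
      have h1 := hM y h
      have h2 := hp x
      simp only [mem_ofPred_eq] at hy
      linarith
    have h := hu y hyB
    unfold laplacian at h
    rw [Finset.sum_eq_zero_iff_of_nonneg] at h
    · have h1 := h z (by simpa using hyz)
      rcases mul_eq_zero.mp h1 with h2 | h2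
      · exact absurd h2 (hc_pos _ _ hyz).ne'
      · exact (sub_eq_zero.mp h2).symm.trans hy
    · intro w hw
      simp only [Finset.mem_filter, Finset.mem_univ, true_and] at hw
      refine mul_nonneg (hc_pos _ _ hw).le (sub_nonneg.mpr ?_)
      rw [hy]; exact hp w
  have h1 := hM b hb
  have h2 := hp x
  simp only [mem_ofPred_eq] at hbp
  linarith

theorem laplacian_neg (u : V → ℝ) (x : V) : laplacian G c (-u) x = -laplacian G c u x := by
  simp only [laplacian, ← Finset.sum_neg_distrib, Pi.neg_apply]
  exact Finset.sum_congr rfl fun _ _ => by ring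

/-- Green's formula. -/
theorem dirichletEnergy_eq_sum (hc_symm : ∀ u v, G.Adj u v → c u v = c v u) (u : V → ℝ) :
    dirichletEnergy G c u = ∑ x, u x * laplacian G c u x := by
  have h1 : ∀ f : G.Dart → ℝ, ∑ x, ∑ d : G.Dart with d.fst = x, f d = ∑ d, f d := fun f =>
    Finset.sum_fiberwise _ _ _
  have h2 : ∑ x, u x * laplacian G c u x = ∑ d : G.Dart, u d.fst * current G c u d := by
    rw [← h1]
    refine Finset.sum_congr rfl fun x _ => ?_
    rw [← divergence_current, divergence_apply, Finset.mul_sum]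
    refine Finset.sum_congr rfl fun d hd => ?_
    rw [(Finset.mem_filter.mp hd).2]
  have h3 : ∑ x, ∑ y with G.Adj x y, c x y * (u x - u y) ^ 2 =
      ∑ d : G.Dart, current G c u d * (u d.fst - u d.snd) := by
    rw [← h1]
    refine Finset.sum_congr rfl fun x _ => ?_
    rw [← sum_dart_fst_eq (fun x y => c x y * (u x - u y) ^ 2)]
    exact Finset.sum_congr rfl fun d _ => by rw [current]; ring
  have h4 := sum_symm fun d : G.Dart => u d.fst * current G c u d
  have h5 : ∑ d : G.Dart, u d.symm.fst * current G c u d.symm =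
      -∑ d : G.Dart, u d.snd * current G c u d := by
    rw [← Finset.sum_neg_distrib]
    refine Finset.sum_congr rfl fun d _ => ?_
    rw [current_mem_flows hc_symm u d]
    change u d.snd * _ = _
    ring
  have h6 : ∑ d : G.Dart, current G c u d * (u d.fst - u d.snd) =
      ∑ d : G.Dart, u d.fst * current G c u d - ∑ d : G.Dart, u d.snd * current G c u d := by
    rw [← Finset.sum_sub_distrib]
    exact Finset.sum_congr rfl fun d _ => by ring
  rw [dirichletEnergy, h3, h6, h2]
  linarith

end Current

/-! ### The Dirichlet problem and its conjugate -/

namespace AnnulusDecomposition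

open scoped Classical

variable {V : Type*} {G : SimpleGraph V}

theorem E₁_nonempty (T : AnnulusDecomposition G) : T.E₁.Nonempty := T.faceVertices_nonempty _

theorem E₂_nonempty (T : AnnulusDecomposition G) : T.E₂.Nonempty := T.faceVertices_nonempty _

/-- The two sides of an edge are different faces. Otherwise the boundary walk of the common face
would turn back at both ends of the edge, which would be the whole graph; but there are two
holes. -/
theorem faceOf_symm_ne (T : AnnulusDecomposition G) (d : G.Dart) :
    T.faceOf d.symm ≠ T.faceOf d := by
  intro hd
  have h1 : T.rot d = d := T.simple_faces _ _ ((T.faceOf_rot d).trans hd) (T.rot_fst d)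
  have h2 : T.rot d.symm = d.symm := T.simple_faces _ _
    ((T.faceOf_rot d.symm).trans (by rw [SimpleGraph.Dart.symm_symm, hd])) (T.rot_fst d.symm)
  have hall : ∀ e : G.Dart, e = d ∨ e = d.symm := by
    intro e
    have h := T.eq_of_invariant T.connected (fun e => e = d ∨ e = d.symm) (fun e => ?_)
      (fun e => ?_) d e
    · exact h.mp (Or.inl rfl)
    · have e1 : e.symm = d ↔ e = d.symm :=
        ⟨fun h => by rw [← h, SimpleGraph.Dart.symm_symm],
          fun h => by rw [h, SimpleGraph.Dart.symm_symm]⟩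
      have e2 : e.symm = d.symm ↔ e = d := SimpleGraph.Dart.symm_involutive.injective.eq_iff
      rw [e1, e2, or_comm]
    · have e1 : T.rot e = d ↔ e = d := by
        conv_lhs => rw [← h1]
        exact T.rot.injective.eq_iff
      have e2 : T.rot e = d.symm ↔ e = d.symm := by
        conv_lhs => rw [← h2]
        exact T.rot.injective.eq_iff
      rw [e1, e2]
  have hface : ∀ F : T.Face, F = T.faceOf d := by
    intro F
    obtain ⟨e, rfl⟩ := Quotient.exists_rep F
    rcases hall e with rfl | rfl
    · rfl
    · exact hd
  obtain ⟨x, hx⟩ := T.E₁_nonempty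
  refine disjoint_left.mp T.disjoint_holes hx ?_
  rw [hface T.hole₂, ← hface T.hole₁]
  exact hx

variable [Fintype V] {T : AnnulusDecomposition G} {c : V → V → ℝ} {k : ℝ} {g : V → ℝ}

namespace IsDirichletSolution

theorem le (hg : T.IsDirichletSolution c k g) (hk : 0 < k)
    (hc_pos : ∀ u v, G.Adj u v → 0 < c u v) (x : V) : g x ≤ k := by
  refine le_of_laplacian_eq_zero T.connected hc_pos (B := T.E₁ ∪ T.E₂)
    (T.E₁_nonempty.mono subset_union_left) ?_ ?_ x
  · rintro x (hx | hx)
    · exact (hg.on_E₁ x hx).le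
    · exact (hg.on_E₂ x hx).le.trans hk.le
  · intro x hx
    exact hg.harmonic x (fun h => hx (Or.inl h)) fun h => hx (Or.inr h)

theorem nonneg (hg : T.IsDirichletSolution c k g) (hk : 0 < k)
    (hc_pos : ∀ u v, G.Adj u v → 0 < c u v) (x : V) : 0 ≤ g x := by
  refine neg_nonpos.mp (le_of_laplacian_eq_zero T.connected hc_pos (u := -g) (B := T.E₁ ∪ T.E₂)
    (T.E₁_nonempty.mono subset_union_left) ?_ ?_ x)
  · rintro x (hx | hx)
    · rw [Pi.neg_apply, hg.on_E₁ x hx]; linarith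
    · rw [Pi.neg_apply, hg.on_E₂ x hx]; linarith
  · intro x hx
    rw [laplacian_neg, hg.harmonic x (fun h => hx (Or.inl h)) fun h => hx (Or.inr h), neg_zero]

theorem totalFlux_eq (hg : T.IsDirichletSolution c k g) :
    T.totalFlux c g = ∑ x with x ∈ T.E₁, laplacian G c g x := by
  refine Finset.sum_congr rfl fun x hx => ?_
  have hx1 := hg.on_E₁ x (Finset.mem_filter.mp hx).2
  rw [normalDerivative, laplacian, Finset.sum_filter, Finset.sum_filter]
  refine Finset.sum_congr rfl fun y _ => ?_
  by_cases hy : y ∈ T.E₁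
  · simp [hy, hx1, hg.on_E₁ y hy]
  · simp [hy]

theorem dirichletEnergy_eq (hg : T.IsDirichletSolution c k g)
    (hc_symm : ∀ u v, G.Adj u v → c u v = c v u) :
    dirichletEnergy G c g = k * T.totalFlux c g := by
  rw [dirichletEnergy_eq_sum hc_symm, hg.totalFlux_eq, Finset.mul_sum, Finset.sum_filter]
  refine Finset.sum_congr rfl fun x _ => ?_
  split_ifs with h1
  · rw [hg.on_E₁ x h1]
  · by_cases h2 : x ∈ T.E₂
    · rw [hg.on_E₂ x h2, zero_mul]
    · rw [hg.harmonic x h1 h2, mul_zero]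

/-- The current across every level is the total flux. -/
theorem sum_current_level (hg : T.IsDirichletSolution c k g)
    (hc_symm : ∀ u v, G.Adj u v → c u v = c v u) {t : ℝ} (h0 : 0 ≤ t) (hk : t < k) :
    ∑ d : G.Dart with t < g d.fst ∧ ¬ t < g d.snd, current G c g d = T.totalFlux c g := by
  rw [← sum_divergence_eq_sum_leaving (current_mem_flows hc_symm g) fun x => t < g x,
    hg.totalFlux_eq, Finset.sum_filter, Finset.sum_filter]
  refine Finset.sum_congr rfl fun x _ => ?_
  rw [divergence_current]
  by_cases h1 : x ∈ T.E₁
  · simp [h1, hg.on_E₁ x h1, hk]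
  by_cases h2 : x ∈ T.E₂
  · simp [h1, hg.on_E₂ x h2, h0.not_gt]
  · simp [hg.harmonic x h1 h2]

theorem exists_crossing (hg : T.IsDirichletSolution c k g) {t : ℝ} (h0 : 0 ≤ t) (hk : t < k) :
    ∃ d : G.Dart, t < g d.fst ∧ ¬ t < g d.snd := by
  by_contra! H
  obtain ⟨x, hx⟩ := T.E₁_nonempty
  obtain ⟨y, hy⟩ := T.E₂_nonempty
  have := T.connected.mem_of_closed (S := {x | t < g x}) (x := x) (by simpa [hg.on_E₁ x hx])
    (fun y z hyz hy => H ⟨(y, z), hyz⟩ hy) y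
  simp only [mem_ofPred_eq, hg.on_E₂ y hy] at this
  linarith

theorem totalFlux_pos (hg : T.IsDirichletSolution c k g) (hk : 0 < k)
    (hc_symm : ∀ u v, G.Adj u v → c u v = c v u) (hc_pos : ∀ u v, G.Adj u v → 0 < c u v) :
    0 < T.totalFlux c g := by
  rw [← hg.sum_current_level hc_symm le_rfl hk]
  obtain ⟨d, hd⟩ := hg.exists_crossing le_rfl hk
  refine Finset.sum_pos (fun d hd => ?_) ⟨d, by simpa using hd⟩
  simp only [Finset.mem_filter, Finset.mem_univ, true_and, not_lt] at hd
  exact current_pos hc_pos (hd.2.trans_lt hd.1)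

/-- The conjugate of `g`: a function on the faces whose differences across the darts are the
currents, modulo the total flux. -/
theorem exists_conjugate (hg : T.IsDirichletSolution c k g)
    (hc_symm : ∀ u v, G.Adj u v → c u v = c v u) :
    ∃ h : T.Face → ℝ, ∀ d : G.Dart, g d.fst ≠ g d.snd → ∃ m : ℤ,
      h (T.faceOf d) = h (T.faceOf d.symm) + current G c g d + m * T.totalFlux c g := by
  obtain ⟨p, hp⟩ := T.E₁_nonempty
  obtain ⟨q, hq⟩ := T.E₂_nonempty
  set C := T.totalFlux c g with hC
  have hflow := current_mem_flows hc_symm g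
  let b₁ : V → ℝ := fun x => if x ∈ T.E₁ then laplacian G c g x else 0
  let b₂ : V → ℝ := fun x => if x ∈ T.E₂ then laplacian G c g x else 0
  have hb : divergence G (current G c g) = b₁ + b₂ := by
    ext x
    rw [divergence_current, Pi.add_apply]
    by_cases h1 : x ∈ T.E₁
    · have h2 : x ∉ T.E₂ := disjoint_left.mp T.disjoint_holes h1
      simp [b₁, b₂, h1, h2]
    · by_cases h2 : x ∈ T.E₂
      · simp [b₁, b₂, h1, h2]
      · simp [b₁, b₂, h1, h2, hg.harmonic x h1 h2]
  have hs₁ : ∑ x, b₁ x = C := by rw [hC, hg.totalFlux_eq, Finset.sum_filter]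
  have hs₂ : ∑ x, b₂ x = -C := by
    have := sum_divergence hflow
    rw [hb] at this
    simp only [Pi.add_apply, Finset.sum_add_distrib, hs₁] at this
    linarith
  -- concentrate the sources at `p` and the sinks at `q`, moving along the boundary curves
  obtain ⟨ψ₁, h11, h12, h13⟩ := exists_flow_concentrating
    (r := fun x y => G.Adj x y ∧ x ∈ T.E₁ ∧ y ∈ T.E₁) (fun _ _ h => h.1) p b₁ fun x hx =>
      T.reflTransGen_of_mem_faceVertices T.hole₁ (by by_contra h; exact hx (if_neg h)) hp
  obtain ⟨ψ₂, h21, h22, h23⟩ := exists_flow_concentrating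
    (r := fun x y => G.Adj x y ∧ x ∈ T.E₂ ∧ y ∈ T.E₂) (fun _ _ h => h.1) q b₂ fun x hx =>
      T.reflTransGen_of_mem_faceVertices T.hole₂ (by by_contra h; exact hx (if_neg h)) hq
  -- an integral flow from `p` to `q`, invisible modulo `C` after multiplication with `C`
  obtain ⟨P, hP1, -, hP3⟩ := exists_unit_flow (G := G) (r := G.Adj) (fun _ _ h => h)
    ((SimpleGraph.reachable_iff_reflTransGen p q).mp (T.connected.preconnected p q))
  obtain ⟨h, hh⟩ := T.exists_faceCoboundary_eq T.connected T.euler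
    (ψ := current G c g - ψ₁ - ψ₂ - C • fun d => (P d : ℝ))
    (Submodule.sub_mem _ (Submodule.sub_mem _ (Submodule.sub_mem _ hflow h11) h21)
      (Submodule.smul_mem _ _ hP1))
    (by
      rw [map_sub, map_sub, map_sub, map_smul, hb, h13, h23, hP3, hs₁, hs₂, smul_sub,
        ← Pi.single_smul, ← Pi.single_smul, smul_eq_mul, mul_one, Pi.single_neg]
      abel)
  refine ⟨h, fun d hd => ⟨-P d, ?_⟩⟩
  have h1 : ψ₁ d = 0 := by
    by_contra hne
    rcases h12 d hne with ⟨-, ha, hb⟩ | ⟨-, ha, hb⟩ <;>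
      exact hd (by rw [hg.on_E₁ _ ha, hg.on_E₁ _ hb])
  have h2 : ψ₂ d = 0 := by
    by_contra hne
    rcases h22 d hne with ⟨-, ha, hb⟩ | ⟨-, ha, hb⟩ <;>
      exact hd (by rw [hg.on_E₂ _ ha, hg.on_E₂ _ hb])
  have h3 := congrFun hh d
  simp only [RotationSystem.faceCoboundary_apply, Pi.sub_apply, Pi.smul_apply, smul_eq_mul, h1,
    h2] at h3
  push_cast
  linarith

end IsDirichletSolution

end AnnulusDecomposition

/-! ### Rectangles in the cylinder -/

theorem addCircle_coe_eq_coe_iff {C x y : ℝ} :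
    (x : AddCircle C) = y ↔ ∃ m : ℤ, x = y + m * C := by
  rw [QuotientAddGroup.eq_iff_sub_mem, AddSubgroup.mem_zmultiples_iff]
  constructor
  · rintro ⟨m, hm⟩
    exact ⟨m, by rw [zsmul_eq_mul] at hm; linarith⟩
  · rintro ⟨m, hm⟩
    exact ⟨m, by rw [zsmul_eq_mul]; linarith⟩

theorem wrap_eq_wrap_iff {C : ℝ} {p q : ℝ × ℝ} :
    wrap C p = wrap C q ↔ (∃ m : ℤ, p.1 = q.1 + m * C) ∧ p.2 = q.2 := by
  rw [wrap, wrap, Prod.mk.injEq, addCircle_coe_eq_coe_iff]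

theorem Rect.isEmbedded_of_width_lt {C : ℝ} (hC : 0 < C) {r : Rect} (hr : r.width < C) :
    r.IsEmbedded C := by
  rintro ⟨x, s⟩ ⟨⟨hx1, hx2⟩, -⟩ ⟨y, s'⟩ ⟨⟨hy1, hy2⟩, -⟩ h
  obtain ⟨⟨m, hm⟩, hs⟩ := wrap_eq_wrap_iff.mp h
  simp only at hx1 hx2 hy1 hy2 hm hs
  have h1 : (m : ℝ) * C < 1 * C := by linarith
  have h2 : (-1 : ℝ) * C < m * C := by linarith
  have h3 : m < 1 := by exact_mod_cast lt_of_mul_lt_mul_right h1 hC.le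
  have h4 : -1 < m := by exact_mod_cast lt_of_mul_lt_mul_right h2 hC.le
  obtain rfl : m = 0 := by omega
  rw [hm, hs]; simp

theorem cylinderArea_eq {C k : ℝ} (hk : 0 < k) (hC : 0 < C) :
    @cylinderArea C k ⟨hC⟩ = k * C := by
  have : Fact (0 < C) := ⟨hC⟩
  rw [cylinderArea, cylinder, MeasureTheory.Measure.volume_eq_prod,
    MeasureTheory.Measure.prod_prod, AddCircle.measure_univ, Real.volume_Icc, sub_zero,
    ENNReal.toReal_mul, ENNReal.toReal_ofReal hC.le, ENNReal.toReal_ofReal hk.le, mul_comm]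

/-! ### The tiling at each level -/

namespace AnnulusDecomposition

namespace IsDirichletSolution

open scoped Classical

variable {V : Type*} [Fintype V] {G : SimpleGraph V} {T : AnnulusDecomposition G}
  {c : V → V → ℝ} {k : ℝ} {g : V → ℝ}

/-- The current along an edge is less than the total flux: the boundary walk of a face beside the
edge, having gone down along it, climbs back across the same level. It does so along another edge,
since the two sides of an edge are different faces, and that edge carries some of the flux. -/
theorem current_lt_totalFlux (hg : T.IsDirichletSolution c k g) (hk : 0 < k)
    (hc_symm : ∀ u v, G.Adj u v → c u v = c v u) (hc_pos : ∀ u v, G.Adj u v → 0 < c u v)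
    {d : G.Dart} (hd : g d.snd < g d.fst) : current G c g d < T.totalFlux c g := by
  rw [← hg.sum_current_level hc_symm (hg.nonneg hk hc_pos d.snd)
    (hd.trans_le (hg.le hk hc_pos d.fst))]
  obtain ⟨e, he, he1, he2⟩ := T.exists_entering_of_leaving (fun x => g d.snd < g x) d hd (by simp)
  have hne : e.symm ≠ d := by
    rintro rfl
    exact T.faceOf_symm_ne e he.symm
  have hmem : e.symm ∈
      Finset.univ.filter fun e : G.Dart => g d.snd < g e.fst ∧ ¬ g d.snd < g e.snd := by
    simp only [Finset.mem_filter, Finset.mem_univ, true_and]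
    exact ⟨he2, he1⟩
  refine Finset.single_lt_sum (j := e.symm) hne (by simpa using hd) hmem ?_ ?_
  · exact current_pos hc_pos ((not_lt.mp he1).trans_lt he2)
  · intro f hf _
    simp only [Finset.mem_filter, Finset.mem_univ, true_and, not_lt] at hf
    exact (current_pos hc_pos (hf.2.trans_lt hf.1)).le

/-- At every level the arcs given by the conjugate function tile the circle. -/
theorem level_tiling (hg : T.IsDirichletSolution c k g) (hk : 0 < k)
    (hc_symm : ∀ u v, G.Adj u v → c u v = c v u) (hc_pos : ∀ u v, G.Adj u v → 0 < c u v)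
    {h : T.Face → ℝ} (hh : ∀ d : G.Dart, g d.fst ≠ g d.snd → ∃ m : ℤ,
      h (T.faceOf d) = h (T.faceOf d.symm) + current G c g d + m * T.totalFlux c g)
    {t : ℝ} (h0 : 0 ≤ t) (htk : t < k) :
    (∀ x : ℝ, ∃ d : G.Dart, g d.snd ≤ t ∧ t < g d.fst ∧
      ∃ y ∈ Icc (h (T.faceOf d.symm)) (h (T.faceOf d.symm) + current G c g d),
        ∃ m : ℤ, x = y + m * T.totalFlux c g) ∧
    (∀ d e : G.Dart, g d.snd ≤ t → t < g d.fst → g e.snd ≤ t → t < g e.fst →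
      ∀ y ∈ Ico (h (T.faceOf d.symm)) (h (T.faceOf d.symm) + current G c g d),
      ∀ y' ∈ Ico (h (T.faceOf e.symm)) (h (T.faceOf e.symm) + current G c g e),
      (∃ m : ℤ, y = y' + m * T.totalFlux c g) → d = e) := by
  let ι := {d : G.Dart // t < g d.fst ∧ ¬ t < g d.snd}
  have hlt : ∀ d : ι, g d.1.snd < g d.1.fst := fun d => (not_lt.mp d.2.2).trans_lt d.2.1
  have : Nonempty ι := by
    obtain ⟨d, hd⟩ := hg.exists_crossing h0 htk
    exact ⟨⟨d, hd⟩⟩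
  have hnext : ∀ d : ι, ∃ e : ι, T.faceOf e.1.symm = T.faceOf d.1 := by
    intro d
    obtain ⟨e, he, he1, he2⟩ := T.exists_entering_of_leaving (fun x => t < g x) d.1 d.2.1 d.2.2
    exact ⟨⟨e.symm, he2, he1⟩, by simpa using he⟩
  choose nxt hnxt using hnext
  obtain ⟨H1, H2⟩ := circle_tiling (hg.totalFlux_pos hk hc_symm hc_pos)
    (fun d : ι => h (T.faceOf d.1.symm)) (fun d => current G c g d.1)
    (fun d => current_pos hc_pos (hlt d))
    (by
      rw [← hg.sum_current_level hc_symm h0 htk]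
      exact (Finset.sum_subtype _ (by simp) fun d => current G c g d).symm)
    nxt (fun d => by rw [hnxt]; exact hh d.1 (hlt d).ne')
  refine ⟨fun x => ?_, fun d e hd1 hd2 he1 he2 y hy y' hy' hm => ?_⟩
  · obtain ⟨d, hd⟩ := H1 x
    exact ⟨d.1, not_lt.mp d.2.2, d.2.1, hd⟩
  · exact congrArg Subtype.val (H2 ⟨d, hd2, not_lt.mpr hd1⟩ ⟨e, he2, not_lt.mpr he1⟩ y hy y' hy' hm)

/-- The interior of a nondegenerate rectangle meets no other nondegenerate closed rectangle: a
common point can be moved slightly downwards and to the left, to the interior of both. -/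
theorem eq_of_overlap (hg : T.IsDirichletSolution c k g) (hk : 0 < k)
    (hc_symm : ∀ u v, G.Adj u v → c u v = c v u) (hc_pos : ∀ u v, G.Adj u v → 0 < c u v)
    {h : T.Face → ℝ} (hh : ∀ d : G.Dart, g d.fst ≠ g d.snd → ∃ m : ℤ,
      h (T.faceOf d) = h (T.faceOf d.symm) + current G c g d + m * T.totalFlux c g)
    {d e : G.Dart} (he : g e.snd < g e.fst) {s y y' : ℝ}
    (hs : s ∈ Ioo (g d.snd) (g d.fst)) (hs' : s ∈ Icc (g e.snd) (g e.fst))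
    (hy : y ∈ Ioo (h (T.faceOf d.symm)) (h (T.faceOf d.symm) + current G c g d))
    (hy' : y' ∈ Icc (h (T.faceOf e.symm)) (h (T.faceOf e.symm) + current G c g e))
    (hm : ∃ m : ℤ, y = y' + m * T.totalFlux c g) : d = e := by
  obtain ⟨m, hm⟩ := hm
  obtain ⟨t, ht1, ht2, ht3, ht4⟩ : ∃ t, g d.snd ≤ t ∧ t < g d.fst ∧ g e.snd ≤ t ∧ t < g e.fst := by
    rcases hs'.2.lt_or_eq with hlt | heq
    · exact ⟨s, hs.1.le, hs.2, hs'.1, hlt⟩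
    · refine ⟨max (g d.snd) (g e.snd), le_max_left _ _, ?_, le_max_right _ _, ?_⟩
      · exact max_lt (hs.1.trans hs.2) (he.trans (heq ▸ hs.2))
      · exact max_lt (heq ▸ hs.1) he
  have hcur := current_pos hc_pos he
  obtain ⟨δ, hδ0, hδ1, hδ2, hδ3⟩ : ∃ δ, 0 ≤ δ ∧ h (T.faceOf d.symm) ≤ y - δ ∧
      h (T.faceOf e.symm) ≤ y' - δ ∧ y' - δ < h (T.faceOf e.symm) + current G c g e := by
    rcases hy'.2.lt_or_eq with hlt | heq
    · exact ⟨0, le_rfl, by linarith [hy.1], by linarith [hy'.1], by linarith⟩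
    · refine ⟨min (y - h (T.faceOf d.symm)) (current G c g e), ?_, ?_, ?_, ?_⟩
      · exact le_min (by linarith [hy.1]) hcur.le
      · linarith [min_le_left (y - h (T.faceOf d.symm)) (current G c g e)]
      · linarith [min_le_right (y - h (T.faceOf d.symm)) (current G c g e)]
      · have : 0 < min (y - h (T.faceOf d.symm)) (current G c g e) :=
          lt_min (by linarith [hy.1]) hcur
        linarith
  exact (hg.level_tiling hk hc_symm hc_pos hh ((hg.nonneg hk hc_pos _).trans ht1)
    (ht2.trans_le (hg.le hk hc_pos _))).2 d e ht1 ht2 ht3 ht4 (y - δ)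
    ⟨hδ1, by linarith [hy.2]⟩ (y' - δ) ⟨hδ2, hδ3⟩ ⟨m, by rw [hm]; ring⟩

/-- The closed rectangles cover the cylinder. -/
theorem exists_cover (hg : T.IsDirichletSolution c k g) (hk : 0 < k)
    (hc_symm : ∀ u v, G.Adj u v → c u v = c v u) (hc_pos : ∀ u v, G.Adj u v → 0 < c u v)
    {h : T.Face → ℝ} (hh : ∀ d : G.Dart, g d.fst ≠ g d.snd → ∃ m : ℤ,
      h (T.faceOf d) = h (T.faceOf d.symm) + current G c g d + m * T.totalFlux c g)
    (x : ℝ) {s : ℝ} (hs : s ∈ Icc 0 k) :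
    ∃ d : G.Dart, g d.snd < g d.fst ∧ s ∈ Icc (g d.snd) (g d.fst) ∧
      ∃ y ∈ Icc (h (T.faceOf d.symm)) (h (T.faceOf d.symm) + current G c g d),
        ∃ m : ℤ, x = y + m * T.totalFlux c g := by
  rcases hs.2.lt_or_eq with hlt | rfl
  · obtain ⟨d, h1, h2, h3⟩ := (hg.level_tiling hk hc_symm hc_pos hh hs.1 hlt).1 x
    exact ⟨d, h1.trans_lt h2, ⟨h1, h2.le⟩, h3⟩
  · -- the upper boundary is covered by the rectangles that cross the highest level below it
    obtain ⟨q, hq⟩ := T.E₂_nonempty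
    obtain ⟨p, hp, hmax⟩ := Finset.exists_max_image (Finset.univ.filter fun x => g x < s) g
      ⟨q, by simpa [hg.on_E₂ q hq] using hk⟩
    simp only [Finset.mem_filter, Finset.mem_univ, true_and] at hp hmax
    obtain ⟨d, h1, h2, h3⟩ :=
      (hg.level_tiling hk hc_symm hc_pos hh (hg.nonneg hk hc_pos p) hp).1 x
    refine ⟨d, h1.trans_lt h2, ⟨h1.trans hp.le, ?_⟩, h3⟩
    by_contra! hlt
    exact absurd (hmax _ hlt) (not_le.mpr h2)

/-- The height of a vertex is also the height of an end of an edge on which `g` is not constant. -/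
theorem exists_nonconstant (hg : T.IsDirichletSolution c k g) (hk : 0 < k) (x : V) :
    ∃ d : G.Dart, g d.snd < g d.fst ∧ g x ∈ ({g d.fst, g d.snd} : Set ℝ) := by
  by_contra! H
  have hall := T.connected.mem_of_closed (S := {y | g y = g x}) (x := x) rfl fun y z hyz hy => by
    simp only [mem_ofPred_eq] at hy ⊢
    rcases lt_trichotomy (g y) (g z) with hlt | heq | hlt
    · exact absurd (by simp [hy]) (H ⟨(z, y), hyz.symm⟩ hlt)
    · rw [← heq, hy]
    · exact absurd (by simp [hy]) (H ⟨(y, z), hyz⟩ hlt)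
  obtain ⟨p, hp⟩ := T.E₁_nonempty
  obtain ⟨q, hq⟩ := T.E₂_nonempty
  have h1 : g p = g x := hall p
  have h2 : g q = g x := hall q
  rw [hg.on_E₁ p hp] at h1
  rw [hg.on_E₂ q hq] at h2
  linarith

end IsDirichletSolution

end AnnulusDecomposition

/-! ### The tiling of the cylinder -/

theorem SimpleGraph.exists_descending_dart {V : Type*} {G : SimpleGraph V} (g : V → ℝ)
    (e : G.edgeSet) : ∃ d : G.Dart, d.edge = e ∧ g d.snd ≤ g d.fst := by
  obtain ⟨e, he⟩ := e
  induction e with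
  | _ x y =>
    rcases le_total (g y) (g x) with h | h
    · exact ⟨⟨(x, y), he⟩, rfl, h⟩
    · exact ⟨⟨(y, x), SimpleGraph.Adj.symm he⟩, Sym2.eq_swap, h⟩

theorem theorem0p4 {V : Type*} [Fintype V] (G : SimpleGraph V) (T : AnnulusDecomposition G)
    (c : V → V → ℝ) (hc_symm : ∀ u v, G.Adj u v → c u v = c v u)
    (hc_pos : ∀ u v, G.Adj u v → 0 < c u v)
    (k : ℝ) (hk : 0 < k) (g : V → ℝ) (hg : T.IsDirichletSolution c k g) :
    ∃ hC : 0 < T.totalFlux c g,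
      (∃ f : G.edgeSet → Rect,
        -- position and dimensions of the rectangle of the edge `[u, v]`
        (∀ u v (huv : G.Adj u v), g v ≤ g u →
          (f ⟨s(u, v), huv⟩).bottom = g v ∧
          (f ⟨s(u, v), huv⟩).height = g u - g v ∧
          (f ⟨s(u, v), huv⟩).width = c u v * (g u - g v)) ∧
        (∀ e, (f e).IsEmbedded (T.totalFlux c g)) ∧
        IsCylinderTiling (T.totalFlux c g) k f ∧
        -- `f` is boundary preserving
        (∀ u v (huv : G.Adj u v), u ∈ T.E₁ →
          wrap (T.totalFlux c g) '' (f ⟨s(u, v), huv⟩).topSide ⊆ univ ×ˢ {k}) ∧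
        (∀ u v (huv : G.Adj u v), u ∈ T.E₂ →
          wrap (T.totalFlux c g) '' (f ⟨s(u, v), huv⟩).bottomSide ⊆ univ ×ˢ {0})) ∧
      dirichletEnergy G c g =
        @cylinderArea (T.totalFlux c g) k ⟨hC⟩ := by
  classical
  have hC := hg.totalFlux_pos hk hc_symm hc_pos
  have hle := hg.le hk hc_pos
  have hnonneg := hg.nonneg hk hc_pos
  refine ⟨hC, ?_, by rw [hg.dirichletEnergy_eq hc_symm, cylinderArea_eq hk hC]⟩
  obtain ⟨h, hh⟩ := hg.exists_conjugate hc_symm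
  choose D hD1 hD2 using hg.exists_nonconstant hk
  choose o ho1 ho2 using SimpleGraph.exists_descending_dart (G := G) g
  -- a degenerate rectangle is placed at a left corner of a nondegenerate one
  let l : G.Dart → ℝ := fun d =>
    if g d.snd < g d.fst then h (T.faceOf d.symm) else h (T.faceOf (D d.fst).symm)
  have hl : ∀ {d : G.Dart}, g d.snd < g d.fst → l d = h (T.faceOf d.symm) := fun hd => if_pos hd
  let f : G.edgeSet → Rect := fun e =>
    ⟨l (o e), g (o e).snd, current G c g (o e), g (o e).fst - g (o e).snd⟩
  have hoeq : ∀ d : G.Dart, g d.snd < g d.fst → o ⟨d.edge, d.edge_mem⟩ = d := by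
    intro d hd
    rcases (SimpleGraph.dart_edge_eq_iff _ _).mp (ho1 ⟨d.edge, d.edge_mem⟩) with h1 | h1
    · exact h1
    · have := ho2 ⟨d.edge, d.edge_mem⟩
      rw [h1] at this
      exact absurd hd this.not_gt
  have hdim : ∀ u v (huv : G.Adj u v), g v ≤ g u →
      (f ⟨s(u, v), huv⟩).bottom = g v ∧ (f ⟨s(u, v), huv⟩).height = g u - g v ∧
        (f ⟨s(u, v), huv⟩).width = c u v * (g u - g v) := by
    intro u v huv hle
    rcases hle.lt_or_eq with hlt | heq
    · have : o ⟨s(u, v), huv⟩ = ⟨(u, v), huv⟩ := hoeq ⟨(u, v), huv⟩ hlt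
      simp [f, this, current]
    · have h1 := ho1 ⟨s(u, v), huv⟩
      rcases SimpleGraph.dart_edge_eq_mk'_iff'.mp h1 with ⟨h2, h3⟩ | ⟨h2, h3⟩ <;>
        simp [f, current, h2, h3, heq]
  -- a rectangle of positive width comes from an edge on which `g` is not constant
  have hpos : ∀ {e} {y : ℝ}, y ∈ Ioo (f e).left ((f e).left + (f e).width) →
      g (o e).snd < g (o e).fst := by
    intro e y hy
    refine (ho2 e).lt_of_ne fun heq => ?_
    have h1 := hy.1.trans hy.2
    simp [f, current, heq] at h1
  refine ⟨f, hdim, fun e => ?_, ⟨?_, ?_⟩, ?_, ?_⟩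
  · refine Rect.isEmbedded_of_width_lt hC ?_
    rcases (ho2 e).lt_or_eq with hlt | heq
    · exact hg.current_lt_totalFlux hk hc_symm hc_pos hlt
    · simpa [f, current, heq] using hC
  · apply subset_antisymm
    · refine iUnion_subset fun e => ?_
      rintro _ ⟨⟨y, s⟩, ⟨-, hs1, hs2⟩, rfl⟩
      simp only [f] at hs1 hs2
      exact ⟨mem_univ _, (hnonneg _).trans hs1, by
        change s ≤ k
        linarith [hle (o e).fst]⟩
    · rintro ⟨x, s⟩ ⟨-, hs⟩
      obtain ⟨x, rfl⟩ := QuotientAddGroup.mk_surjective x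
      obtain ⟨d, hd, hds, y, hy, hm⟩ := hg.exists_cover hk hc_symm hc_pos hh x hs
      refine mem_iUnion.mpr ⟨⟨d.edge, d.edge_mem⟩, (y, s), ?_, ?_⟩
      · simp only [Rect.box, f, hoeq d hd, hl hd]
        exact ⟨hy, hds.1, by simpa using hds.2⟩
      · exact (wrap_eq_wrap_iff (p := (x, s)) (q := (y, s)).mpr ⟨hm, rfl⟩).symm
  · intro i j hij
    rw [disjoint_left]
    rintro _ ⟨⟨y, s⟩, ⟨hy, hs⟩, rfl⟩ ⟨⟨y', s'⟩, ⟨hy', hs'⟩, heq⟩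
    obtain ⟨hm, rfl⟩ := wrap_eq_wrap_iff.mp heq.symm
    have hi := hpos hy
    have hs : s ∈ Ioo (g (o i).snd) (g (o i).fst) := by simpa [f] using hs
    have hs' : s ∈ Icc (g (o j).snd) (g (o j).fst) := by simpa [f] using hs'
    have hy : y ∈ Ioo (h (T.faceOf (o i).symm))
        (h (T.faceOf (o i).symm) + current G c g (o i)) := by simpa only [f, hl hi] using hy
    rcases (ho2 j).lt_or_eq with hj | hj
    · have hy' : y' ∈ Icc (h (T.faceOf (o j).symm))
          (h (T.faceOf (o j).symm) + current G c g (o j)) := by simpa only [f, hl hj] using hy'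
      have hoo := hg.eq_of_overlap hk hc_symm hc_pos hh hj hs hs' hy hy' hm
      exact hij (Subtype.ext (by rw [← ho1 i, ← ho1 j, hoo]))
    · have hy'' : y' = h (T.faceOf (D (o j).fst).symm) := by
        simpa [f, current, l, hj] using hy'
      have hsj : s = g (o j).fst := by simpa [hj] using hs'
      have hDj := hD2 (o j).fst
      rw [← hsj] at hDj
      have hcur := current_pos hc_pos (hD1 (o j).fst)
      have hoo := hg.eq_of_overlap hk hc_symm hc_pos hh (e := D (o j).fst) (y' := y') (hD1 _) hs
        (by
          rcases hDj with h1 | h1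
          · rw [h1]; exact ⟨(hD1 _).le, le_rfl⟩
          · rw [h1]; exact ⟨le_rfl, (hD1 _).le⟩)
        hy ⟨hy''.ge, by linarith⟩ hm
      -- but then the point would be on a horizontal side of the rectangle of `i`
      rw [← hoo] at hDj
      rcases hDj with h1 | h1
      · exact hs.2.ne h1
      · exact hs.1.ne' h1
  · rintro u v huv hu _ ⟨⟨y, s⟩, ⟨-, hs⟩, rfl⟩
    obtain ⟨h1, h2, -⟩ := hdim u v huv (by rw [hg.on_E₁ u hu]; exact hle v)
    refine ⟨mem_univ _, ?_⟩
    change s = k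
    rw [show s = _ from hs, h1, h2, ← hg.on_E₁ u hu]; ring
  · rintro u v huv hu _ ⟨⟨y, s⟩, ⟨-, hs⟩, rfl⟩
    obtain ⟨h1, -, -⟩ := hdim v u huv.symm (by rw [hg.on_E₂ u hu]; exact hnonneg v)
    refine ⟨mem_univ _, ?_⟩
    change s = 0
    have hswap : (⟨s(u, v), huv⟩ : G.edgeSet) = ⟨s(v, u), huv.symm⟩ := Subtype.ext Sym2.eq_swap
    rw [show s = _ from hs, hswap, h1, hg.on_E₂ u hu]
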